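/- Let $\mathcal H$ be a separable complex Hilbert space. For a bounded operator $A$ on $\mathcal H$ put $|A|=(A^*A)^{1/2}$, and for $0<p<\infty$ let $\|A\|_p=(\operatorname{tr}|A|^p)^{1/p}\in[0,\infty]$, where $\operatorname{tr}$ is the usual trace of positive operators; let $C_p$ be the Schatten $p$-class, i.e. the set of compact operators $A$ on $\mathcal H$ with $\|A\|_p<\infty$. Let $p>0$ and let $A_1,\dots,A_n\in C_p$ with $\sum_{i=1}^n A_i=0$. Then all operators $A_i\pm A_j$ belong to $C_p$, and the following hold. (1) If $0<p\le 2$, then, for each choice of the sign $\pm$ (the same sign in all terms of the sum), $$\sum_{i,j=1}^n\|A_i\pm A_j\|_p^2\le 2n^{2/p}\sum_{i=1}^n\|A_i\|_p^2 .$$ (2) If $2\le p<\infty$, then, for each choice of the sign $\pm$ (the same sign in all terms of the sum), $$2n^{2/p}\sum_{i=1}^n\|A_i\|_p^2\le \sum_{i,j=1}^n\|A_i\pm A_j\|_p^2 .$$ (3) In particular, if $p=2$, then $$\sum_{i,j=1}^n\|A_i-A_j\|_2^2=2n\sum_{i=1}^n\|A_i\|_2^2 .$$ -/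

import Mathlib

open scoped ENNReal InnerProductSpace

noncomputable section

namespace Schatten

variable {H : Type*} [NormedAddCommGroup H] [InnerProductSpace ℂ H] [CompleteSpace H]

/-- The index set of a fixed orthonormal (Hilbert) basis of `H`. -/
def basisIndex (H : Type*) [NormedAddCommGroup H] [InnerProductSpace ℂ H] [CompleteSpace H] :
    Set H :=
  (exists_hilbertBasis ℂ H).choose

/-- A fixed orthonormal (Hilbert) basis of `H`. -/
def basis (H : Type*) [NormedAddCommGroup H] [InnerProductSpace ℂ H] [CompleteSpace H] :
    HilbertBasis (basisIndex H) ℂ H :=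
  (exists_hilbertBasis ℂ H).choose_spec.choose

/-- The usual trace `∑ᵢ ⟪eᵢ, T eᵢ⟫ ∈ [0, ∞]` of a positive operator `T` (only used for positive
operators). By `posTrace_eq` it does not depend on the orthonormal basis. -/
def posTrace (T : H →L[ℂ] H) : ℝ≥0∞ :=
  ∑' i, ENNReal.ofReal (⟪basis H i, T (basis H i)⟫_ℂ).re

/-- `‖A‖ₚ = (tr |A|ᵖ)^(1/p) ∈ [0, ∞]`, where `|A| = (A⋆ A)^(1/2)` and the powers of `|A|`
are those of the continuous functional calculus. -/
def eSchattenNorm (p : ℝ) (A : H →L[ℂ] H) : ℝ≥0∞ :=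
  posTrace (CFC.abs A ^ p) ^ (1 / p)

/-- The Schatten `p`-class: compact operators with finite Schatten `p`-norm. -/
def schattenClass (H : Type*) [NormedAddCommGroup H] [InnerProductSpace ℂ H] [CompleteSpace H]
    (p : ℝ) : Set (H →L[ℂ] H) :=
  {A | IsCompactOperator A ∧ eSchattenNorm p A < ∞}

/-- The Schatten `p`-norm (quasi-norm for `p < 1`) as a real number, meaningful on the Schatten
`p`-class. -/
def schattenNorm (p : ℝ) (A : H →L[ℂ] H) : ℝ :=
  (eSchattenNorm p A).toReal

set_option linter.unusedSectionVars false in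
theorem ofReal_norm_sq_eq_tsum {ι : Type*} (b : HilbertBasis ι ℂ H) (x : H) :
    ENNReal.ofReal (‖x‖ ^ 2) = ∑' i, ENNReal.ofReal (‖⟪b i, x⟫_ℂ‖ ^ 2) := by
  have h := (b.hasSum_inner_mul_inner x x).mapL Complex.reCLM
  have h2 : HasSum (fun i => ‖⟪b i, x⟫_ℂ‖ ^ 2) (‖x‖ ^ 2) := by
    convert h using 1
    · funext i
      rw [← inner_conj_symm x (b i), Complex.conj_mul']
      simp [← Complex.ofReal_pow]
    · rw [inner_self_eq_norm_sq_to_K]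
      simp [← Complex.ofReal_pow]
  rw [← h2.tsum_eq, ENNReal.ofReal_tsum_of_nonneg (fun _ => by positivity) h2.summable]

/-- The trace of a positive operator may be computed in any orthonormal basis. -/
theorem posTrace_eq {ι : Type*} (b : HilbertBasis ι ℂ H) {T : H →L[ℂ] H} (hT : 0 ≤ T) :
    posTrace T = ∑' i, ENNReal.ofReal (⟪b i, T (b i)⟫_ℂ).re := by
  set S := CFC.sqrt T with hS
  have hSS : S * S = T := CFC.sqrt_mul_sqrt_self T hT
  have hsym : ∀ x y, ⟪S x, y⟫_ℂ = ⟪x, S y⟫_ℂ := by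
    have h : IsSelfAdjoint S := (CFC.sqrt_nonneg T).isSelfAdjoint
    exact fun x y => h.isSymmetric x y
  have hx : ∀ x, (⟪x, T x⟫_ℂ).re = ‖S x‖ ^ 2 := by
    intro x
    rw [← hSS, mul_apply_eq_comp, ← hsym, inner_self_eq_norm_sq_to_K]
    simp [← Complex.ofReal_pow]
  unfold posTrace
  simp only [hx]
  rw [tsum_congr (fun i => ofReal_norm_sq_eq_tsum b (S (basis H i))), ENNReal.tsum_comm]
  refine tsum_congr fun j => ?_
  rw [ofReal_norm_sq_eq_tsum (basis H)]
  refine tsum_congr fun i => ?_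
  rw [← hsym, ← inner_conj_symm, RCLike.norm_conj]

end Schatten

end

/-! Since `∑ A i = 0`, the cross terms cancel and, for either sign, `∑ |A i ± A j|²` equals `2n ∑ |A
i|²`. Put `q = p / 2`; then `‖A‖ₚ²` is the `q`-(quasi-)norm of the positive operator `|A|²`. For `q
≤ 1`, reverse Minkowski (`sum_posTrace_rpow_le`), subadditivity of `tr Y^q`
(`posTrace_sum_rpow_le_sum_posTrace_rpow`) and the power mean inequality give the bound; for `q ≥ 1`
all three reverse.

Both trace inequalities become scalar in an eigenbasis `z k`, `ζ k` of the sum `Z`. Minkowski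
follows from Peierls' inequality. Sub- and superadditivity follow from Jensen's inequality with
weights `ζ k⁻¹ |⟪b i, z k⟫|² ξ i`, where `b i`, `ξ i` diagonalise a summand `X ≤ Z`: for fixed `i`
they have total mass at most one (`tsum_inv_mul_overlap_mul_le_one`) and average `ζ` to `ξ i`. -/

/-! ### Scalar Jensen, Minkowski and power mean inequalities. -/

namespace ENNReal

/-- Jensen's inequality for convex powers and sub-probability weights. -/
theorem rpow_tsum_mul_le_tsum_mul_rpow {ι : Type*} {q : ℝ} (hq : 1 ≤ q) (w a : ι → ℝ≥0∞)
    (hw : ∑' i, w i ≤ 1) : (∑' i, w i * a i) ^ q ≤ ∑' i, w i * a i ^ q := by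
  have hq0 : 0 < q := by linarith
  have h : ∑' i, w i * a i ≤ (∑' i, w i * a i ^ q) ^ q⁻¹ := by
    rw [ENNReal.tsum_eq_iSup_sum]
    refine iSup_le fun s => ?_
    refine (inner_le_weight_mul_Lp_of_nonneg s hq w a).trans ?_
    have h1 : (∑ i ∈ s, w i) ^ (1 - q⁻¹) ≤ 1 :=
      rpow_le_one ((ENNReal.sum_le_tsum s).trans hw) (by simpa using inv_le_one_of_one_le₀ hq)
    calc _ ≤ 1 * (∑' i, w i * a i ^ q) ^ q⁻¹ :=
          mul_le_mul' h1 (rpow_le_rpow (ENNReal.sum_le_tsum s) (by positivity))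
      _ = _ := one_mul _
  calc _ ≤ ((∑' i, w i * a i ^ q) ^ q⁻¹) ^ q := rpow_le_rpow h hq0.le
    _ = _ := rpow_inv_rpow hq0.ne' _

/-- Jensen's inequality for concave powers and sub-probability weights. -/
theorem tsum_mul_rpow_le_rpow_tsum_mul {ι : Type*} {q : ℝ} (hq0 : 0 < q) (hq : q ≤ 1)
    (w a : ι → ℝ≥0∞) (hw : ∑' i, w i ≤ 1) :
    ∑' i, w i * a i ^ q ≤ (∑' i, w i * a i) ^ q := by
  have h := rpow_tsum_mul_le_tsum_mul_rpow (one_le_inv_iff₀.2 ⟨hq0, hq⟩) w (fun i => a i ^ q) hw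
  simp only [rpow_rpow_inv hq0.ne'] at h
  exact (rpow_inv_le_iff hq0).1 h

theorem Lp_sum_le {ι κ : Type*} {r : ℝ} (hr : 1 ≤ r) (s : Finset ι) (t : Finset κ)
    (f : ι → κ → ℝ≥0∞) :
    (∑ i ∈ s, (∑ k ∈ t, f i k) ^ r) ^ (1 / r) ≤ ∑ k ∈ t, (∑ i ∈ s, f i k ^ r) ^ (1 / r) := by
  have hr0 : 0 < r := by linarith
  classical
  induction t using Finset.induction_on with
  | empty => simp [hr0]
  | insert k t hk ih =>
    simp only [Finset.sum_insert hk]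
    exact (Lp_add_le s _ _ hr).trans (by gcongr)

theorem Lp_tsum_sum_le {ι κ : Type*} {r : ℝ} (hr : 1 ≤ r) (t : Finset κ) (f : ι → κ → ℝ≥0∞) :
    (∑' i, (∑ k ∈ t, f i k) ^ r) ^ (1 / r) ≤ ∑ k ∈ t, (∑' i, f i k ^ r) ^ (1 / r) := by
  have hr0 : 0 < r := by linarith
  rw [one_div, rpow_inv_le_iff hr0, ENNReal.tsum_eq_iSup_sum]
  refine iSup_le fun s => ?_
  rw [← rpow_inv_le_iff hr0, ← one_div]
  refine (Lp_sum_le hr s t f).trans ?_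
  gcongr
  exact ENNReal.sum_le_tsum s

/-- This is Minkowski with exponent `1 / r` applied to `f ^ r`, the two indices trading roles; the
infinite sum over `k` is reached as a limit of finite ones. -/
theorem sum_Lp_tsum_le {ι κ : Type*} {r : ℝ} (hr0 : 0 < r) (hr : r ≤ 1) (s : Finset ι)
    (f : ι → κ → ℝ≥0∞) :
    ∑ i ∈ s, (∑' k, f i k ^ r) ^ (1 / r) ≤ (∑' k, (∑ i ∈ s, f i k) ^ r) ^ (1 / r) := by
  have hfin : ∀ t : Finset κ,
      ∑ i ∈ s, (∑ k ∈ t, f i k ^ r) ^ (1 / r) ≤ (∑' k, (∑ i ∈ s, f i k) ^ r) ^ (1 / r) := by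
    intro t
    have h := Lp_sum_le (one_le_inv_iff₀.2 ⟨hr0, hr⟩) s t (fun i k => f i k ^ r)
    simp only [rpow_rpow_inv hr0.ne', one_div, inv_inv] at h
    rw [one_div, le_rpow_inv_iff hr0]
    exact h.trans (ENNReal.sum_le_tsum t)
  refine le_of_tendsto' (tendsto_finsetSum s fun i _ => ?_) hfin (x := Filter.atTop)
  exact ((ENNReal.continuous_rpow_const (y := 1 / r)).tendsto _).comp ENNReal.summable.hasSum

theorem sum_le_card_rpow_mul_Lp {ι : Type*} {r : ℝ} (hr : 1 ≤ r) (s : Finset ι) (f : ι → ℝ≥0∞) :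
    ∑ i ∈ s, f i ≤ (s.card : ℝ≥0∞) ^ (1 - 1 / r) * (∑ i ∈ s, f i ^ r) ^ (1 / r) := by
  simpa using inner_le_weight_mul_Lp_of_nonneg s hr (fun _ => 1) f

theorem Lp_le_card_rpow_mul_sum {ι : Type*} {r : ℝ} (hr0 : 0 < r) (hr : r ≤ 1) (s : Finset ι)
    (f : ι → ℝ≥0∞) :
    (∑ i ∈ s, f i ^ r) ^ (1 / r) ≤ (s.card : ℝ≥0∞) ^ (1 / r - 1) * ∑ i ∈ s, f i := by
  have h := rpow_le_rpow (sum_le_card_rpow_mul_Lp (one_le_inv_iff₀.2 ⟨hr0, hr⟩) s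
    (fun i => f i ^ r)) (one_div_nonneg.2 hr0.le)
  simp only [rpow_rpow_inv hr0.ne', one_div, inv_inv] at h
  rw [mul_rpow_of_nonneg _ _ (inv_nonneg.2 hr0.le), rpow_rpow_inv hr0.ne', ← rpow_mul] at h
  rw [one_div]
  convert h using 3
  field_simp

end ENNReal

/-! ### Eigenbases and the functional calculus. -/

namespace Schatten
variable {H : Type*} [NormedAddCommGroup H] [InnerProductSpace ℂ H] [CompleteSpace H]

open scoped ComplexOrder in
/-- A compact positive operator has an orthonormal basis of eigenvectors. -/
theorem exists_eigenbasis.{u} {H : Type u} [NormedAddCommGroup H] [InnerProductSpace ℂ H]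
    [CompleteSpace H] {X : H →L[ℂ] H} (hX : 0 ≤ X) (hc : IsCompactOperator X) :
    ∃ (ι : Type u) (b : HilbertBasis ι ℂ H) (ξ : ι → NNReal), ∀ i, X (b i) = (ξ i : ℂ) • b i := by
  have hpos : X.IsPositive := (ContinuousLinearMap.nonneg_iff_isPositive X).1 hX
  have hsym : (X : H →ₗ[ℂ] H).IsSymmetric := hpos.isSymmetric
  have hclosed : ∀ μ : ℂ, IsClosed (Module.End.eigenspace (X : H →ₗ[ℂ] H) μ : Set H) := by
    intro μ
    have : (Module.End.eigenspace (X : H →ₗ[ℂ] H) μ : Set H) = {x | X x = μ • x} := by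
      ext x; simp
    rw [this]
    exact isClosed_eq X.continuous (continuous_const_smul μ)
  have hcomp : ∀ μ : ℂ, CompleteSpace (Module.End.eigenspace (X : H →ₗ[ℂ] H) μ) :=
    fun μ => (hclosed μ).completeSpace_coe
  choose w b hb using fun μ : ℂ =>
    exists_hilbertBasis ℂ (Module.End.eigenspace (X : H →ₗ[ℂ] H) μ)
  have hon := hsym.orthogonalFamily_eigenspaces.orthonormal_sigma_orthonormal
    (v_family := fun μ i => b μ i) (fun μ => (b μ).orthonormal)
  let v : (Σ μ, w μ) → H := fun a => (b a.1 a.2 : H)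
  have hev : ∀ a, X (v a) = a.1 • v a := fun a =>
    Module.End.mem_eigenspace_iff.1 (b a.1 a.2).2
  -- A vector orthogonal to every `v a` projects to zero in each eigenspace, and the eigenspaces of
  -- a compact symmetric operator have trivial joint orthogonal complement.
  have hbot : (Submodule.span ℂ (Set.range v))ᗮ = ⊥ := by
    rw [eq_bot_iff, ← ContinuousLinearMap.orthogonalComplement_iSup_eigenspaces_eq_bot hc hsym]
    intro x hx
    rw [← Submodule.iInf_orthogonal, Submodule.mem_iInf]
    intro μ
    set E := Module.End.eigenspace (X : H →ₗ[ℂ] H) μ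
    have h0 : E.orthogonalProjectionOnto x = 0 := by
      refine (b μ).repr.injective (lp.ext (funext fun i => ?_))
      rw [HilbertBasis.repr_apply_apply, Submodule.inner_orthogonalProjectionOnto_eq_of_mem_left, map_zero]
      exact (Submodule.mem_orthogonal _ x).1 hx _ (Submodule.subset_span ⟨⟨μ, i⟩, rfl⟩)
    exact Submodule.orthogonalProjectionOnto_eq_zero_iff.1 h0
  let B := HilbertBasis.mkOfOrthogonalEqBot hon hbot
  have hB : ∀ a, B a = v a := fun a => by simp [B, v]
  have hre : ∀ a : Σ μ, w μ, 0 ≤ a.1.re ∧ a.1 = (a.1.re : ℂ) := by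
    intro a
    have h := hpos.inner_nonneg_right (v a)
    have hn : ‖v a‖ = 1 := hon.1 a
    rw [hev, inner_smul_right, inner_self_eq_norm_sq_to_K, hn] at h
    have h' : 0 ≤ a.1 := by simpa using h
    rw [Complex.nonneg_iff] at h'
    exact ⟨h'.1, Complex.ext rfl (by simpa using h'.2.symm)⟩
  refine ⟨_, B, fun a => ⟨a.1.re, (hre a).1⟩, fun a => ?_⟩
  rw [hB, hev]
  congr 1
  exact (hre a).2

/-- The claim holds for constants and the identity and survives sums, products and uniform limits,
so Stone–Weierstrass gives all continuous functions on the spectrum. -/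
theorem cfc_apply_eigenvector {X : H →L[ℂ] H} (hX : IsSelfAdjoint X) {f : ℝ → ℝ}
    (hf : ContinuousOn f (spectrum ℝ X)) {ξ : ℝ} {v : H}
    (hv : X v = (ξ : ℂ) • v) : cfc f X v = (f ξ : ℂ) • v := by
  by_cases hv0 : v = 0
  · simp [hv0]
  have hξ : ξ ∈ spectrum ℝ X := by
    rw [spectrum.mem_iff]
    intro hu
    obtain ⟨Y, hY⟩ := hu.exists_left_inv
    apply hv0
    have h1 : (algebraMap ℝ (H →L[ℂ] H) ξ - X) v = 0 := by
      rw [sub_apply, hv, Algebra.algebraMap_eq_smul_one]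
      simp
    calc v = (Y * (algebraMap ℝ (H →L[ℂ] H) ξ - X)) v := by rw [hY]; rfl
      _ = Y ((algebraMap ℝ (H →L[ℂ] H) ξ - X) v) := rfl
      _ = 0 := by rw [h1, map_zero]
  rw [cfc_apply f X]
  have key : ∀ g : C(spectrum ℝ X, ℝ), cfcHom hX g v = ((g ⟨ξ, hξ⟩ : ℝ) : ℂ) • v := by
    intro g
    induction g using ContinuousMap.induction_on_of_compact with
    | const r =>
      have : ContinuousMap.const (spectrum ℝ X) r = algebraMap ℝ C(spectrum ℝ X, ℝ) r := rfl
      rw [this, AlgHomClass.commutes, Algebra.algebraMap_eq_smul_one]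
      simp
    | id => simpa [cfcHom_id hX] using hv
    | star_id => simpa [map_star, cfcHom_id hX, hX.star_eq] using hv
    | add f g hf hg =>
      rw [map_add, add_apply, hf, hg, ← add_smul]
      simp
    | mul f g hf hg =>
      rw [map_mul, mul_apply_eq_comp, hg, map_smul, hf, smul_smul]
      simp [mul_comm]
    | frequently f h =>
      refine h.mem_of_closed (isClosed_eq ?_ ?_)
      · have := cfcHom_continuous (R := ℝ) hX
        fun_prop
      · fun_prop
  rw [key]
  rfl

end Schatten

/-! ### Quadratic forms and overlaps of two eigenbases. -/

namespace Schatten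
variable {H : Type*} [NormedAddCommGroup H] [InnerProductSpace ℂ H]

/-- The quadratic form `⟪e, X e⟫ ∈ [0, ∞]` of a positive operator `X`. -/
noncomputable def form (X : H →L[ℂ] H) (e : H) : ℝ≥0∞ := ENNReal.ofReal (⟪e, X e⟫_ℂ).re

/-- The transition probability `|⟪x, y⟫|²`. -/
noncomputable def overlap (x y : H) : ℝ≥0∞ := ENNReal.ofReal (‖⟪x, y⟫_ℂ‖ ^ 2)

theorem overlap_comm (x y : H) : overlap x y = overlap y x := by
  rw [overlap, overlap, norm_inner_symm]

theorem form_mono {X Z : H →L[ℂ] H} (h : X ≤ Z) (e : H) : form X e ≤ form Z e := by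
  have h1 := ((ContinuousLinearMap.le_def X Z).1 h).re_inner_nonneg_right e
  rw [sub_apply, inner_sub_right, map_sub] at h1
  exact ENNReal.ofReal_le_ofReal (sub_nonneg.1 h1)

theorem re_inner_nonneg {X : H →L[ℂ] H} (hX : 0 ≤ X) (e : H) : 0 ≤ (⟪e, X e⟫_ℂ).re :=
  ((ContinuousLinearMap.nonneg_iff_isPositive X).1 hX).re_inner_nonneg_right e

theorem form_sum {κ : Type*} (s : Finset κ) {X : κ → H →L[ℂ] H} (hX : ∀ i ∈ s, 0 ≤ X i) (e : H) :
    form (∑ i ∈ s, X i) e = ∑ i ∈ s, form (X i) e := by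
  simp only [form]
  rw [← ENNReal.ofReal_sum_of_nonneg fun i hi => re_inner_nonneg (hX i hi) e]
  simp

theorem form_eigenbasis {ι : Type*} {b : HilbertBasis ι ℂ H} {X : H →L[ℂ] H}
    {ξ : ι → NNReal} (hb : ∀ i, X (b i) = (ξ i : ℂ) • b i) (i : ι) :
    form X (b i) = ξ i := by
  rw [form, hb, inner_smul_right, inner_self_eq_norm_sq_to_K, b.orthonormal.1]
  simp

theorem isCompactOperator_sum {κ : Type*} {s : Finset κ} {X : κ → H →L[ℂ] H}
    (hc : ∀ i ∈ s, IsCompactOperator (X i)) : IsCompactOperator (∑ i ∈ s, X i : H →L[ℂ] H) :=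
  (compactOperator (RingHom.id ℂ) H H).sum_mem hc

section Eigenbasis

variable {ι κ : Type*} {b : HilbertBasis ι ℂ H} {z : HilbertBasis κ ℂ H} {X Z : H →L[ℂ] H}
  {ξ : ι → NNReal} {ζ : κ → NNReal}

theorem form_eq_tsum (hX : 0 ≤ X) (hb : ∀ i, X (b i) = (ξ i : ℂ) • b i) (e : H) :
    form X e = ∑' i, overlap (b i) e * ξ i := by
  have hsym : ∀ x y, ⟪X x, y⟫_ℂ = ⟪x, X y⟫_ℂ :=
    ((ContinuousLinearMap.nonneg_iff_isPositive X).1 hX).isSymmetric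
  have h := (b.hasSum_inner_mul_inner e (X e)).mapL Complex.reCLM
  have h2 : HasSum (fun i => ‖⟪b i, e⟫_ℂ‖ ^ 2 * (ξ i : ℝ)) (⟪e, X e⟫_ℂ).re := by
    convert h using 1
    · funext i
      rw [← hsym, hb, inner_smul_left, Complex.reCLM_apply, mul_left_comm,
        ← inner_conj_symm e (b i), Complex.conj_mul']
      simp [← Complex.ofReal_pow, mul_comm]
    · rfl
  rw [form, ← h2.tsum_eq, ENNReal.ofReal_tsum_of_nonneg (fun _ => by positivity) h2.summable]
  refine tsum_congr fun i => ?_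
  rw [overlap, ENNReal.ofReal_mul (by positivity), ENNReal.ofReal_coe_nnreal]

theorem overlap_mul_le_form (hX : 0 ≤ X) (hb : ∀ i, X (b i) = (ξ i : ℂ) • b i) (e : H) (i : ι) :
    overlap (b i) e * ξ i ≤ form X e := by
  rw [form_eq_tsum hX hb]
  exact ENNReal.le_tsum i

theorem overlap_mul_le_eigenvalue (hX : 0 ≤ X) (hXZ : X ≤ Z)
    (hb : ∀ i, X (b i) = (ξ i : ℂ) • b i) (hz : ∀ k, Z (z k) = (ζ k : ℂ) • z k) (i : ι) (k : κ) :
    overlap (b i) (z k) * ξ i ≤ ζ k := by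
  rw [← form_eigenbasis hz]
  exact (overlap_mul_le_form hX hb _ i).trans (form_mono hXZ _)

/-- Formally, `ξ i |b i⟩⟨b i| ≤ X ≤ Z` forces `ξ i ⟪b i, Z⁻¹ b i⟫ ≤ 1`. Finite partial sums avoid
inverting `Z`. -/
theorem tsum_inv_mul_overlap_mul_le_one (hX : 0 ≤ X) (hXZ : X ≤ Z)
    (hb : ∀ i, X (b i) = (ξ i : ℂ) • b i) (hz : ∀ k, Z (z k) = (ζ k : ℂ) • z k) (i : ι) :
    ∑' k, (ζ k : ℝ≥0∞)⁻¹ * (overlap (b i) (z k) * ξ i) ≤ 1 := by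
  rcases eq_or_ne (ξ i) 0 with h0 | h0
  · simp [h0]
  rw [ENNReal.tsum_eq_iSup_sum]
  refine iSup_le fun F => ?_
  set c : κ → ℂ := fun k => ⟪z k, b i⟫_ℂ with hc
  have hov : ∀ k, overlap (b i) (z k) = ENNReal.ofReal (‖c k‖ ^ 2) := fun k => overlap_comm _ _
  set S : ℝ := ∑ k ∈ F, (ζ k : ℝ)⁻¹ * ‖c k‖ ^ 2 with hS
  have hS0 : 0 ≤ S := Finset.sum_nonneg fun k _ => by positivity
  have hsum : ∑ k ∈ F, (ζ k : ℝ≥0∞)⁻¹ * (overlap (b i) (z k) * ξ i)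
      = ENNReal.ofReal (S * ξ i) := by
    rw [hS, Finset.sum_mul, ENNReal.ofReal_sum_of_nonneg fun k _ => by positivity]
    refine Finset.sum_congr rfl fun k _ => ?_
    -- The inverse of zero is `∞` in `ℝ≥0∞` but `0` in `ℝ`; both terms vanish because `X ≤ Z` makes
    -- `overlap (b i) (z k) * ξ i` zero there.
    rcases eq_or_ne (ζ k) 0 with hk | hk
    · have := overlap_mul_le_eigenvalue hX hXZ hb hz i k
      rw [hk, ENNReal.coe_zero, nonpos_iff_eq_zero] at this
      simp [this, hk]
    · rw [hov, mul_assoc, ENNReal.ofReal_mul (by positivity), ENNReal.ofReal_mul (by positivity),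
        ENNReal.ofReal_coe_nnreal, ← NNReal.coe_inv, ENNReal.ofReal_coe_nnreal, ENNReal.coe_inv hk]
  -- The test vector is `Z⁻¹ b i` truncated to `F`. It satisfies `⟪b i, v⟫ = ⟪v, Z v⟫ = S`, so
  -- testing the forms on it gives `S² ξ i ≤ S`.
  set v : H := ∑ k ∈ F, (((ζ k : ℝ)⁻¹ : ℝ) * c k : ℂ) • z k with hv
  have hbv : ⟪b i, v⟫_ℂ = (S : ℂ) := by
    rw [hv, inner_sum, hS, Complex.ofReal_sum]
    refine Finset.sum_congr rfl fun k _ => ?_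
    rw [inner_smul_right, ← inner_conj_symm (b i) (z k), mul_assoc, Complex.mul_conj']
    push_cast
    rfl
  have hvZ : (⟪v, Z v⟫_ℂ).re = S := by
    have hZv : Z v = ∑ k ∈ F, ((((ζ k : ℝ)⁻¹ : ℝ) * c k) * (ζ k : ℝ) : ℂ) • z k := by
      rw [hv, map_sum]
      refine Finset.sum_congr rfl fun k _ => ?_
      rw [map_smul, hz, smul_smul]
    rw [hZv, hv, z.orthonormal.inner_sum, Complex.re_sum]
    refine Finset.sum_congr rfl fun k _ => ?_
    have : (starRingEnd ℂ) (((ζ k : ℝ)⁻¹ : ℝ) * c k) * ((((ζ k : ℝ)⁻¹ : ℝ) * c k) * (ζ k : ℝ))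
        = (((ζ k : ℝ)⁻¹ * (ζ k : ℝ)⁻¹ * (ζ k : ℝ) * ‖c k‖ ^ 2 : ℝ) : ℂ) := by
      push_cast
      rw [← Complex.conj_mul', map_mul]
      simp only [map_inv₀, Complex.conj_ofReal]
      ring
    rw [this, Complex.ofReal_re]
    rcases eq_or_ne (ζ k : ℝ) 0 with hk | hk
    · simp [hk]
    · field_simp
  have hle := (overlap_mul_le_form hX hb v i).trans (form_mono hXZ v)
  rw [form, hvZ, overlap, hbv, Complex.norm_real, Real.norm_eq_abs, sq_abs,
    ← ENNReal.ofReal_coe_nnreal, ← ENNReal.ofReal_mul (by positivity),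
    ENNReal.ofReal_le_ofReal_iff hS0] at hle
  rw [hsum, ENNReal.ofReal_le_one]
  rcases hS0.eq_or_lt with h | h
  · simp [← h]
  · exact le_of_mul_le_mul_left (by linarith [hle]) h

theorem tsum_tsum_inv_mul_overlap (hX : 0 ≤ X) (hb : ∀ i, X (b i) = (ξ i : ℂ) • b i) (q : ℝ) :
    ∑' i, ∑' k, (ζ k : ℝ≥0∞)⁻¹ * (overlap (b i) (z k) * ξ i) * (ζ k : ℝ≥0∞) ^ q
      = ∑' k, (ζ k : ℝ≥0∞)⁻¹ * form X (z k) * (ζ k : ℝ≥0∞) ^ q := by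
  rw [ENNReal.tsum_comm]
  refine tsum_congr fun k => ?_
  rw [ENNReal.tsum_mul_right, ENNReal.tsum_mul_left, form_eq_tsum hX hb]

variable [CompleteSpace H]

theorem tsum_overlap {ι : Type*} (b : HilbertBasis ι ℂ H) {x : H} (hx : ‖x‖ = 1) :
    ∑' i, overlap (b i) x = 1 := by
  simp only [overlap]
  rw [← ofReal_norm_sq_eq_tsum b x, hx]
  simp

theorem rpow_apply_eigenbasis (hX : 0 ≤ X) (hb : ∀ i, X (b i) = (ξ i : ℂ) • b i)
    {q : ℝ} (hq : 0 < q) (i : ι) : (X ^ q) (b i) = ((ξ i ^ q : NNReal) : ℂ) • b i := by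
  rw [CFC.rpow_eq_cfc_real hX, cfc_apply_eigenvector (IsSelfAdjoint.of_nonneg hX)
    (Real.continuous_rpow_const hq.le).continuousOn (hb i)]
  simp

theorem posTrace_rpow_eq_tsum (hX : 0 ≤ X) (hb : ∀ i, X (b i) = (ξ i : ℂ) • b i)
    {q : ℝ} (hq : 0 < q) : posTrace (X ^ q) = ∑' i, (ξ i : ℝ≥0∞) ^ q := by
  rw [posTrace_eq b CFC.rpow_nonneg]
  refine tsum_congr fun i => ?_
  have := form_eigenbasis (rpow_apply_eigenbasis hX hb hq) i
  rw [form] at this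
  rw [this, ENNReal.coe_rpow_of_nonneg _ hq.le]

theorem posTrace_rpow_eq_tsum_tsum (hX : 0 ≤ X) (hb : ∀ i, X (b i) = (ξ i : ℂ) • b i)
    (z : HilbertBasis κ ℂ H) {q : ℝ} (hq : 0 < q) :
    posTrace (X ^ q) = ∑' k, ∑' i, overlap (b i) (z k) * (ξ i : ℝ≥0∞) ^ q := by
  rw [posTrace_eq z CFC.rpow_nonneg]
  refine tsum_congr fun k => ?_
  have := form_eq_tsum CFC.rpow_nonneg (rpow_apply_eigenbasis hX hb hq) (z k)
  rw [form] at this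
  simp only [this, ENNReal.coe_rpow_of_nonneg _ hq.le]

theorem tsum_inv_mul_overlap_mul_mul (hX : 0 ≤ X) (hXZ : X ≤ Z)
    (hb : ∀ i, X (b i) = (ξ i : ℂ) • b i) (hz : ∀ k, Z (z k) = (ζ k : ℂ) • z k) (i : ι) :
    ∑' k, (ζ k : ℝ≥0∞)⁻¹ * (overlap (b i) (z k) * ξ i) * ζ k = ξ i := by
  have h1 : ∀ k, (ζ k : ℝ≥0∞)⁻¹ * (overlap (b i) (z k) * ξ i) * ζ k
      = overlap (z k) (b i) * ξ i := by
    intro k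
    rw [overlap_comm (z k)]
    rcases eq_or_ne (ζ k) 0 with hk | hk
    · have := overlap_mul_le_eigenvalue hX hXZ hb hz i k
      rw [hk, ENNReal.coe_zero, nonpos_iff_eq_zero] at this
      simp [this]
    · rw [mul_comm, ← mul_assoc, ENNReal.mul_inv_cancel (by simpa using hk) (by simp), one_mul]
  simp only [h1]
  rw [ENNReal.tsum_mul_right, tsum_overlap z (b.orthonormal.1 i), one_mul]

/-- For each `i`, Jensen applies to the weights above, whose average of `ζ` is `ξ i`; summing over
`i` turns the overlaps into `form X (z k)`. -/
theorem posTrace_rpow_le_tsum_form (hX : 0 ≤ X) (hXZ : X ≤ Z)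
    (hb : ∀ i, X (b i) = (ξ i : ℂ) • b i) (hz : ∀ k, Z (z k) = (ζ k : ℂ) • z k)
    {q : ℝ} (hq : 1 ≤ q) :
    posTrace (X ^ q) ≤ ∑' k, (ζ k : ℝ≥0∞)⁻¹ * form X (z k) * (ζ k : ℝ≥0∞) ^ q := by
  rw [posTrace_rpow_eq_tsum hX hb (by linarith), ← tsum_tsum_inv_mul_overlap hX hb]
  refine ENNReal.tsum_le_tsum fun i => ?_
  have h := ENNReal.rpow_tsum_mul_le_tsum_mul_rpow hq _ (fun k => (ζ k : ℝ≥0∞))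
    (tsum_inv_mul_overlap_mul_le_one hX hXZ hb hz i)
  rwa [tsum_inv_mul_overlap_mul_mul hX hXZ hb hz i] at h

theorem tsum_form_le_posTrace_rpow (hX : 0 ≤ X) (hXZ : X ≤ Z)
    (hb : ∀ i, X (b i) = (ξ i : ℂ) • b i) (hz : ∀ k, Z (z k) = (ζ k : ℂ) • z k)
    {q : ℝ} (hq0 : 0 < q) (hq : q ≤ 1) :
    ∑' k, (ζ k : ℝ≥0∞)⁻¹ * form X (z k) * (ζ k : ℝ≥0∞) ^ q ≤ posTrace (X ^ q) := by
  rw [posTrace_rpow_eq_tsum hX hb hq0, ← tsum_tsum_inv_mul_overlap hX hb]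
  refine ENNReal.tsum_le_tsum fun i => ?_
  have h := ENNReal.tsum_mul_rpow_le_rpow_tsum_mul hq0 hq _ (fun k => (ζ k : ℝ≥0∞))
    (tsum_inv_mul_overlap_mul_le_one hX hXZ hb hz i)
  rwa [tsum_inv_mul_overlap_mul_mul hX hXZ hb hz i] at h

end Eigenbasis

/-! ### Trace inequalities for positive compact operators. -/

section Compact

variable [CompleteSpace H] {X Z : H →L[ℂ] H} {κ : Type*}

/-- Peierls' inequality for convex powers. -/
theorem tsum_form_rpow_le_posTrace_rpow (hX : 0 ≤ X) (hc : IsCompactOperator X)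
    (z : HilbertBasis κ ℂ H) {q : ℝ} (hq : 1 ≤ q) :
    ∑' k, form X (z k) ^ q ≤ posTrace (X ^ q) := by
  obtain ⟨ι, b, ξ, hb⟩ := exists_eigenbasis hX hc
  rw [posTrace_rpow_eq_tsum_tsum hX hb z (by linarith)]
  refine ENNReal.tsum_le_tsum fun k => ?_
  rw [form_eq_tsum hX hb]
  exact ENNReal.rpow_tsum_mul_le_tsum_mul_rpow hq _ _ (tsum_overlap b (z.orthonormal.1 k)).le

/-- Peierls' inequality for concave powers. -/
theorem posTrace_rpow_le_tsum_form_rpow (hX : 0 ≤ X) (hc : IsCompactOperator X)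
    (z : HilbertBasis κ ℂ H) {q : ℝ} (hq0 : 0 < q) (hq : q ≤ 1) :
    posTrace (X ^ q) ≤ ∑' k, form X (z k) ^ q := by
  obtain ⟨ι, b, ξ, hb⟩ := exists_eigenbasis hX hc
  rw [posTrace_rpow_eq_tsum_tsum hX hb z hq0]
  refine ENNReal.tsum_le_tsum fun k => ?_
  rw [form_eq_tsum hX hb]
  exact ENNReal.tsum_mul_rpow_le_rpow_tsum_mul hq0 hq _ _ (tsum_overlap b (z.orthonormal.1 k)).le

/-- In an eigenbasis of `Z` one has `form X (z k) ≤ ζ k`. Peierls transfers this to traces for `q ≤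
1`, the weighted Jensen bound for `q ≥ 1`. -/
theorem posTrace_rpow_mono (hX : 0 ≤ X) (hXZ : X ≤ Z) (hcX : IsCompactOperator X)
    (hcZ : IsCompactOperator Z) {q : ℝ} (hq : 0 < q) : posTrace (X ^ q) ≤ posTrace (Z ^ q) := by
  obtain ⟨κ, z, ζ, hz⟩ := exists_eigenbasis (hX.trans hXZ) hcZ
  rw [posTrace_rpow_eq_tsum (hX.trans hXZ) hz hq]
  rcases le_total q 1 with h | h
  · refine (posTrace_rpow_le_tsum_form_rpow hX hcX z hq h).trans ?_
    refine ENNReal.tsum_le_tsum fun k => ENNReal.rpow_le_rpow ?_ hq.le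
    rw [← form_eigenbasis hz]
    exact form_mono hXZ _
  · obtain ⟨ι, b, ξ, hb⟩ := exists_eigenbasis hX hcX
    refine (posTrace_rpow_le_tsum_form hX hXZ hb hz h).trans ?_
    refine ENNReal.tsum_le_tsum fun k => ?_
    calc _ ≤ (ζ k : ℝ≥0∞)⁻¹ * ζ k * (ζ k : ℝ≥0∞) ^ q := by
          gcongr
          rw [← form_eigenbasis hz]
          exact form_mono hXZ _
      _ ≤ 1 * (ζ k : ℝ≥0∞) ^ q := by
          gcongr
          exact ENNReal.inv_mul_le_one _
      _ = _ := one_mul _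

variable {s : Finset κ} {Y : κ → H →L[ℂ] H}

/-- Minkowski's inequality for positive compact operators. -/
theorem posTrace_sum_rpow_le (hY : ∀ i ∈ s, 0 ≤ Y i) (hc : ∀ i ∈ s, IsCompactOperator (Y i))
    {q : ℝ} (hq : 1 ≤ q) :
    posTrace ((∑ i ∈ s, Y i) ^ q) ^ (1 / q) ≤ ∑ i ∈ s, posTrace (Y i ^ q) ^ (1 / q) := by
  have hZ := Finset.sum_nonneg hY
  obtain ⟨ι, z, ζ, hz⟩ := exists_eigenbasis hZ (isCompactOperator_sum hc)
  rw [posTrace_rpow_eq_tsum hZ hz (by linarith)]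
  -- Each eigenvalue of the sum is the sum of the forms of the summands, so scalar Minkowski
  -- applies, and Peierls bounds each resulting term.
  simp only [← form_eigenbasis hz, form_sum s hY]
  refine (ENNReal.Lp_tsum_sum_le hq s _).trans (Finset.sum_le_sum fun i hi => ?_)
  exact ENNReal.rpow_le_rpow (tsum_form_rpow_le_posTrace_rpow (hY i hi) (hc i hi) z hq)
    (by positivity)

/-- The reverse Minkowski inequality for positive compact operators. -/
theorem sum_posTrace_rpow_le (hY : ∀ i ∈ s, 0 ≤ Y i) (hc : ∀ i ∈ s, IsCompactOperator (Y i))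
    {q : ℝ} (hq0 : 0 < q) (hq : q ≤ 1) :
    ∑ i ∈ s, posTrace (Y i ^ q) ^ (1 / q) ≤ posTrace ((∑ i ∈ s, Y i) ^ q) ^ (1 / q) := by
  have hZ := Finset.sum_nonneg hY
  obtain ⟨ι, z, ζ, hz⟩ := exists_eigenbasis hZ (isCompactOperator_sum hc)
  rw [posTrace_rpow_eq_tsum hZ hz hq0]
  simp only [← form_eigenbasis hz, form_sum s hY]
  refine le_trans (Finset.sum_le_sum fun i hi => ?_) (ENNReal.sum_Lp_tsum_le hq0 hq s _)
  exact ENNReal.rpow_le_rpow (posTrace_rpow_le_tsum_form_rpow (hY i hi) (hc i hi) z hq0 hq)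
    (by positivity)

theorem tsum_sum_form (hY : ∀ i ∈ s, 0 ≤ Y i) {ι : Type*} {z : HilbertBasis ι ℂ H}
    {ζ : ι → NNReal} (hz : ∀ k, (∑ i ∈ s, Y i) (z k) = (ζ k : ℂ) • z k) {q : ℝ} (hq : 0 < q) :
    ∑ i ∈ s, ∑' k, (ζ k : ℝ≥0∞)⁻¹ * form (Y i) (z k) * (ζ k : ℝ≥0∞) ^ q
      = posTrace ((∑ i ∈ s, Y i) ^ q) := by
  rw [posTrace_rpow_eq_tsum (Finset.sum_nonneg hY) hz hq,
    ← Summable.tsum_finsetSum fun _ _ => ENNReal.summable]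
  refine tsum_congr fun k => ?_
  rw [← Finset.sum_mul, ← Finset.mul_sum, ← form_sum s hY, form_eigenbasis hz]
  rcases eq_or_ne (ζ k) 0 with hk | hk
  · simp [hk, hq]
  · rw [ENNReal.inv_mul_cancel (by simpa using hk) (by simp), one_mul]

/-- `tsum_sum_form` splits the trace on the right into one share per summand, and since `Y i` is at
most the sum, the Jensen bound compares each share with `posTrace (Y i ^ q)`. -/
theorem sum_posTrace_rpow_le_posTrace_sum_rpow (hY : ∀ i ∈ s, 0 ≤ Y i)
    (hc : ∀ i ∈ s, IsCompactOperator (Y i)) {q : ℝ} (hq : 1 ≤ q) :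
    ∑ i ∈ s, posTrace (Y i ^ q) ≤ posTrace ((∑ i ∈ s, Y i) ^ q) := by
  obtain ⟨ι, z, ζ, hz⟩ := exists_eigenbasis (Finset.sum_nonneg hY) (isCompactOperator_sum hc)
  rw [← tsum_sum_form hY hz (by linarith)]
  refine Finset.sum_le_sum fun i hi => ?_
  obtain ⟨_, b, ξ, hb⟩ := exists_eigenbasis (hY i hi) (hc i hi)
  exact posTrace_rpow_le_tsum_form (hY i hi) (Finset.single_le_sum hY hi) hb hz hq

theorem posTrace_sum_rpow_le_sum_posTrace_rpow (hY : ∀ i ∈ s, 0 ≤ Y i)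
    (hc : ∀ i ∈ s, IsCompactOperator (Y i)) {q : ℝ} (hq0 : 0 < q) (hq : q ≤ 1) :
    posTrace ((∑ i ∈ s, Y i) ^ q) ≤ ∑ i ∈ s, posTrace (Y i ^ q) := by
  obtain ⟨ι, z, ζ, hz⟩ := exists_eigenbasis (Finset.sum_nonneg hY) (isCompactOperator_sum hc)
  rw [← tsum_sum_form hY hz hq0]
  refine Finset.sum_le_sum fun i hi => ?_
  obtain ⟨_, b, ξ, hb⟩ := exists_eigenbasis (hY i hi) (hc i hi)
  exact tsum_form_le_posTrace_rpow (hY i hi) (Finset.single_le_sum hY hi) hb hz hq0 hq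

/-- Homogeneity of the Schatten quasi-norm on positive compact operators. -/
theorem posTrace_smul_rpow (hX : 0 ≤ X) (hc : IsCompactOperator X) (c : NNReal)
    {q : ℝ} (hq : 0 < q) :
    posTrace ((c • X) ^ q) ^ (1 / q) = c * posTrace (X ^ q) ^ (1 / q) := by
  obtain ⟨ι, b, ξ, hb⟩ := exists_eigenbasis hX hc
  have hb' : ∀ i, (c • X) (b i) = ((c * ξ i : NNReal) : ℂ) • b i := by
    intro i
    rw [smul_apply, hb, NNReal.smul_def, RCLike.real_smul_eq_coe_smul (K := ℂ), smul_smul]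
    simp
  rw [posTrace_rpow_eq_tsum hX hb hq, posTrace_rpow_eq_tsum (smul_nonneg zero_le hX) hb' hq]
  simp only [ENNReal.coe_mul, ENNReal.mul_rpow_of_nonneg _ _ hq.le]
  rw [ENNReal.tsum_mul_left, ENNReal.mul_rpow_of_nonneg _ _ (by positivity), one_div,
    ENNReal.rpow_rpow_inv hq.ne']

end Compact
end Schatten

/-! ### Schatten classes as vector spaces. -/

namespace Schatten
variable {H : Type*} [NormedAddCommGroup H] [InnerProductSpace ℂ H] [CompleteSpace H]

theorem posTrace_abs_rpow (A : H →L[ℂ] H) {p : ℝ} (hp : 0 < p) :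
    posTrace (CFC.abs A ^ p) = posTrace ((star A * A) ^ (p / 2)) := by
  rw [CFC.abs, CFC.sqrt_eq_rpow, CFC.rpow_rpow_of_exponent_nonneg _ _ _ (by norm_num) hp.le]
  congr 2
  ring

theorem eSchattenNorm_sq (A : H →L[ℂ] H) {p : ℝ} (hp : 0 < p) :
    eSchattenNorm p A ^ 2 = posTrace ((star A * A) ^ (p / 2)) ^ (1 / (p / 2)) := by
  rw [eSchattenNorm, posTrace_abs_rpow A hp, ← ENNReal.rpow_natCast, ← ENNReal.rpow_mul]
  congr 1
  push_cast
  field_simp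

theorem isCompactOperator_star_mul_self {A : H →L[ℂ] H} (hA : IsCompactOperator A) :
    IsCompactOperator (star A * A : H →L[ℂ] H) :=
  hA.clm_comp (star A)

theorem posTrace_sum_rpow_lt_top {κ : Type*} {s : Finset κ} {Y : κ → H →L[ℂ] H}
    (hY : ∀ i ∈ s, 0 ≤ Y i) (hc : ∀ i ∈ s, IsCompactOperator (Y i)) {q : ℝ} (hq : 0 < q)
    (hfin : ∀ i ∈ s, posTrace (Y i ^ q) < ∞) : posTrace ((∑ i ∈ s, Y i) ^ q) < ∞ := by
  rcases le_total q 1 with h | h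
  · exact (posTrace_sum_rpow_le_sum_posTrace_rpow hY hc hq h).trans_lt (ENNReal.sum_lt_top.2 hfin)
  · have h1 := (posTrace_sum_rpow_le hY hc h).trans_lt (ENNReal.sum_lt_top.2 fun i hi =>
      ENNReal.rpow_lt_top_of_nonneg (by positivity) (hfin i hi).ne)
    exact (ENNReal.rpow_lt_top_iff_of_pos (by positivity)).1 h1

theorem eSchattenNorm_lt_top_iff (A : H →L[ℂ] H) {p : ℝ} (hp : 0 < p) :
    eSchattenNorm p A < ∞ ↔ posTrace ((star A * A) ^ (p / 2)) < ∞ := by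
  rw [eSchattenNorm, posTrace_abs_rpow A hp, ENNReal.rpow_lt_top_iff_of_pos (by positivity)]

theorem parallelogram (A B : H →L[ℂ] H) :
    star (A + B) * (A + B) + star (A - B) * (A - B)
      = (star A * A + star B * B) + (star A * A + star B * B) := by
  rw [star_add, star_sub]
  noncomm_ring

theorem neg_mem_schattenClass {p : ℝ} {A : H →L[ℂ] H} (hA : A ∈ schattenClass H p) :
    -A ∈ schattenClass H p := by
  refine ⟨hA.1.neg, ?_⟩
  rw [eSchattenNorm, CFC.abs_neg]
  exact hA.2

theorem add_mem_schattenClass {p : ℝ} (hp : 0 < p) {A B : H →L[ℂ] H}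
    (hA : A ∈ schattenClass H p) (hB : B ∈ schattenClass H p) : A + B ∈ schattenClass H p := by
  refine ⟨hA.1.add hB.1, ?_⟩
  have hA2 := (eSchattenNorm_lt_top_iff A hp).1 hA.2
  have hB2 := (eSchattenNorm_lt_top_iff B hp).1 hB.2
  rw [eSchattenNorm_lt_top_iff _ hp]
  -- Two copies of each square: the parallelogram law dominates `|A + B|²` by `2|A|² + 2|B|²`.
  let Y : Fin 4 → H →L[ℂ] H := ![star A * A, star B * B, star A * A, star B * B]
  have hle : star (A + B) * (A + B) ≤ ∑ i, Y i := by
    have : ∑ i, Y i = star (A + B) * (A + B) + star (A - B) * (A - B) := by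
      rw [parallelogram, Fin.sum_univ_four, add_assoc]
      rfl
    rw [this]
    exact le_add_of_nonneg_right (star_mul_self_nonneg _)
  have hY : ∀ i ∈ Finset.univ, 0 ≤ Y i := by
    intro i _
    fin_cases i <;> exact star_mul_self_nonneg _
  have hc : ∀ i ∈ Finset.univ, IsCompactOperator (Y i) := by
    intro i _
    fin_cases i
    exacts [isCompactOperator_star_mul_self hA.1, isCompactOperator_star_mul_self hB.1,
      isCompactOperator_star_mul_self hA.1, isCompactOperator_star_mul_self hB.1]
  refine (posTrace_rpow_mono (star_mul_self_nonneg _) hle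
    (isCompactOperator_star_mul_self (hA.1.add hB.1)) (isCompactOperator_sum hc)
    (half_pos hp)).trans_lt (posTrace_sum_rpow_lt_top hY hc (half_pos hp) ?_)
  intro i _
  fin_cases i
  exacts [hA2, hB2, hA2, hB2]

theorem sub_mem_schattenClass {p : ℝ} (hp : 0 < p) {A B : H →L[ℂ] H}
    (hA : A ∈ schattenClass H p) (hB : B ∈ schattenClass H p) : A - B ∈ schattenClass H p := by
  rw [sub_eq_add_neg]
  exact add_mem_schattenClass hp hA (neg_mem_schattenClass hB)

/-! ### Sums of squared norms. -/

section SquareSums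

variable {n : ℕ} {A : Fin n → H →L[ℂ] H}

theorem sum_star_mul_self_add (hsum : ∑ i, A i = 0) :
    ∑ x : Fin n × Fin n, star (A x.1 + A x.2) * (A x.1 + A x.2)
      = (2 * n : NNReal) • ∑ i, star (A i) * A i := by
  have h : ∑ i, ∑ j, star (A i) * A j = 0 := by simp [← Finset.mul_sum, hsum]
  have h' : ∑ i, ∑ j, star (A j) * A i = 0 := by rw [Finset.sum_comm]; exact h
  rw [Fintype.sum_prod_type]
  simp only [star_add, add_mul, mul_add, Finset.sum_add_distrib, h, h']
  simp only [Finset.sum_const, Finset.card_univ, Fintype.card_fin, ← Finset.smul_sum, add_zero,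
    zero_add]
  rw [mul_smul, ← Nat.cast_smul_eq_nsmul NNReal, two_smul]

theorem sum_star_mul_self_sub (hsum : ∑ i, A i = 0) :
    ∑ x : Fin n × Fin n, star (A x.1 - A x.2) * (A x.1 - A x.2)
      = (2 * n : NNReal) • ∑ i, star (A i) * A i := by
  have h : ∑ i, ∑ j, star (A i) * A j = 0 := by simp [← Finset.mul_sum, hsum]
  have h' : ∑ i, ∑ j, star (A j) * A i = 0 := by rw [Finset.sum_comm]; exact h
  rw [Fintype.sum_prod_type]
  simp only [star_sub, sub_mul, mul_sub, Finset.sum_sub_distrib, h, h']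
  simp only [Finset.sum_const, Finset.card_univ, Fintype.card_fin, ← Finset.smul_sum, sub_zero,
    zero_sub, sub_neg_eq_add]
  rw [mul_smul, ← Nat.cast_smul_eq_nsmul NNReal, two_smul]

theorem two_mul_natCast_mul_rpow (hn : n ≠ 0) {q : ℝ} (x : ℝ≥0∞) :
    ((2 * n : NNReal) : ℝ≥0∞) * ((n : ℝ≥0∞) ^ (1 / q - 1) * x) = 2 * (n : ℝ≥0∞) ^ (1 / q) * x := by
  have h : (n : ℝ≥0∞) * (n : ℝ≥0∞) ^ (1 / q - 1) = (n : ℝ≥0∞) ^ (1 / q) := by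
    conv_lhs => rw [← ENNReal.rpow_one (n : ℝ≥0∞), ← ENNReal.rpow_mul, one_mul]
    rw [← ENNReal.rpow_add _ _ (by simpa using hn) (by simp)]
    congr 1
    ring
  push_cast
  rw [← h]
  ring

variable {B : Fin n × Fin n → H →L[ℂ] H} {p : ℝ}

/-- Only the identity `hAB` links `B` to `A`, so both signs are covered at once. The factor `2n`
from `hAB` and `n ^ (1 / q - 1)` from the power mean inequality combine to `2 n ^ (1 / q)`. -/
theorem sum_eSchattenNorm_sq_le (hp : 0 < p) (hp2 : p ≤ 2) (hA : ∀ i, IsCompactOperator (A i))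
    (hB : ∀ x, IsCompactOperator (B x))
    (hAB : ∑ x, star (B x) * B x = (2 * n : NNReal) • ∑ i, star (A i) * A i) :
    ∑ x, eSchattenNorm p (B x) ^ 2
      ≤ 2 * (n : ℝ≥0∞) ^ (1 / (p / 2)) * ∑ i, eSchattenNorm p (A i) ^ 2 := by
  rcases eq_or_ne n 0 with rfl | hn
  · simp
  have hq : 0 < p / 2 := half_pos hp
  have hq1 : p / 2 ≤ 1 := by linarith
  have hcA : ∀ i ∈ Finset.univ, IsCompactOperator (star (A i) * A i : H →L[ℂ] H) :=
    fun i _ => isCompactOperator_star_mul_self (hA i)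
  have hpA : ∀ i ∈ Finset.univ, 0 ≤ star (A i) * A i := fun i _ => star_mul_self_nonneg _
  simp only [eSchattenNorm_sq _ hp]
  refine (sum_posTrace_rpow_le (fun x _ => star_mul_self_nonneg _)
    (fun x _ => isCompactOperator_star_mul_self (hB x)) hq hq1).trans ?_
  rw [hAB, posTrace_smul_rpow (Finset.sum_nonneg hpA) (isCompactOperator_sum hcA) _ hq,
    ← two_mul_natCast_mul_rpow hn]
  gcongr
  refine (ENNReal.rpow_le_rpow (posTrace_sum_rpow_le_sum_posTrace_rpow hpA hcA hq hq1)
    (by positivity)).trans ?_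
  have h := ENNReal.Lp_le_card_rpow_mul_sum hq hq1 Finset.univ
    (fun i => posTrace ((star (A i) * A i) ^ (p / 2)) ^ (1 / (p / 2)))
  simpa only [one_div, ENNReal.rpow_inv_rpow hq.ne', Finset.card_univ, Fintype.card_fin] using h

theorem le_sum_eSchattenNorm_sq (hp2 : 2 ≤ p) (hA : ∀ i, IsCompactOperator (A i))
    (hB : ∀ x, IsCompactOperator (B x))
    (hAB : ∑ x, star (B x) * B x = (2 * n : NNReal) • ∑ i, star (A i) * A i) :
    2 * (n : ℝ≥0∞) ^ (1 / (p / 2)) * ∑ i, eSchattenNorm p (A i) ^ 2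
      ≤ ∑ x, eSchattenNorm p (B x) ^ 2 := by
  rcases eq_or_ne n 0 with rfl | hn
  · simp
  have hp : 0 < p := by linarith
  have hq : 0 < p / 2 := half_pos hp
  have hq1 : 1 ≤ p / 2 := by linarith
  have hcA : ∀ i ∈ Finset.univ, IsCompactOperator (star (A i) * A i : H →L[ℂ] H) :=
    fun i _ => isCompactOperator_star_mul_self (hA i)
  have hpA : ∀ i ∈ Finset.univ, 0 ≤ star (A i) * A i := fun i _ => star_mul_self_nonneg _
  simp only [eSchattenNorm_sq _ hp]
  refine le_trans ?_ (posTrace_sum_rpow_le (fun x _ => star_mul_self_nonneg _)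
    (fun x _ => isCompactOperator_star_mul_self (hB x)) hq1)
  rw [hAB, posTrace_smul_rpow (Finset.sum_nonneg hpA) (isCompactOperator_sum hcA) _ hq,
    ← two_mul_natCast_mul_rpow hn]
  gcongr
  -- The Hölder constant for `q ≥ 1` is the inverse of the factor in the goal.
  have hn0 : (n : ℝ≥0∞) ^ (1 / (p / 2) - 1) * (n : ℝ≥0∞) ^ (1 - 1 / (p / 2)) = 1 := by
    rw [← ENNReal.rpow_add _ _ (by simpa using hn) (by simp)]
    simp
  have h := ENNReal.sum_le_card_rpow_mul_Lp hq1 Finset.univ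
    (fun i => posTrace ((star (A i) * A i) ^ (p / 2)) ^ (1 / (p / 2)))
  simp only [one_div, ENNReal.rpow_inv_rpow hq.ne', Finset.card_univ, Fintype.card_fin] at h hn0 ⊢
  refine (mul_le_mul_right h _).trans ?_
  rw [← mul_assoc, hn0, one_mul]
  exact ENNReal.rpow_le_rpow (sum_posTrace_rpow_le_posTrace_sum_rpow hpA hcA hq1) (by positivity)

theorem sum_schattenNorm_sq {ι : Type*} [Fintype ι] {C : ι → H →L[ℂ] H}
    (hC : ∀ i, C i ∈ schattenClass H p) :
    ∑ i, schattenNorm p (C i) ^ 2 = (∑ i, eSchattenNorm p (C i) ^ 2).toReal := by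
  rw [ENNReal.toReal_sum fun i _ => ENNReal.pow_ne_top (hC i).2.ne]
  simp [schattenNorm]

theorem sum_schattenNorm_sq_le (hp : 0 < p) (hp2 : p ≤ 2) (hA : ∀ i, A i ∈ schattenClass H p)
    (hB : ∀ x, B x ∈ schattenClass H p)
    (hAB : ∑ x, star (B x) * B x = (2 * n : NNReal) • ∑ i, star (A i) * A i) :
    ∑ i, ∑ j, schattenNorm p (B (i, j)) ^ 2
      ≤ 2 * (n : ℝ) ^ (2 / p) * ∑ i, schattenNorm p (A i) ^ 2 := by
  rw [← Fintype.sum_prod_type (fun x => schattenNorm p (B x) ^ 2), sum_schattenNorm_sq hB,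
    sum_schattenNorm_sq hA]
  have h := sum_eSchattenNorm_sq_le hp hp2 (fun i => (hA i).1) (fun x => (hB x).1) hAB
  have hfin : 2 * (n : ℝ≥0∞) ^ (1 / (p / 2)) * ∑ i, eSchattenNorm p (A i) ^ 2 ≠ ∞ :=
    ENNReal.mul_ne_top (ENNReal.mul_ne_top (by simp)
      (ENNReal.rpow_ne_top_of_nonneg (by positivity) (by simp)))
      (ENNReal.sum_ne_top.2 fun i _ => ENNReal.pow_ne_top (hA i).2.ne)
  have h' := ENNReal.toReal_mono hfin h
  rwa [ENNReal.toReal_mul, ENNReal.toReal_mul, ← ENNReal.toReal_rpow, one_div_div] at h'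

theorem le_sum_schattenNorm_sq (hp2 : 2 ≤ p) (hA : ∀ i, A i ∈ schattenClass H p)
    (hB : ∀ x, B x ∈ schattenClass H p)
    (hAB : ∑ x, star (B x) * B x = (2 * n : NNReal) • ∑ i, star (A i) * A i) :
    2 * (n : ℝ) ^ (2 / p) * ∑ i, schattenNorm p (A i) ^ 2
      ≤ ∑ i, ∑ j, schattenNorm p (B (i, j)) ^ 2 := by
  rw [← Fintype.sum_prod_type (fun x => schattenNorm p (B x) ^ 2), sum_schattenNorm_sq hB,
    sum_schattenNorm_sq hA]
  have h := le_sum_eSchattenNorm_sq hp2 (fun i => (hA i).1) (fun x => (hB x).1) hAB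
  have h' := ENNReal.toReal_mono
    (ENNReal.sum_ne_top.2 fun x _ => ENNReal.pow_ne_top (hB x).2.ne) h
  rwa [ENNReal.toReal_mul, ENNReal.toReal_mul, ← ENNReal.toReal_rpow, one_div_div] at h'

end SquareSums
end Schatten

theorem mainTheorem4 {H : Type*} [NormedAddCommGroup H] [InnerProductSpace ℂ H]
    [CompleteSpace H] [TopologicalSpace.SeparableSpace H]
    (p : ℝ) (hp : 0 < p) (n : ℕ) (A : Fin n → H →L[ℂ] H)
    (hA : ∀ i, A i ∈ Schatten.schattenClass H p) (hsum : ∑ i, A i = 0) :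
    (∀ i j, A i + A j ∈ Schatten.schattenClass H p ∧ A i - A j ∈ Schatten.schattenClass H p) ∧
    (p ≤ 2 →
      ∑ i, ∑ j, Schatten.schattenNorm p (A i + A j) ^ 2
          ≤ 2 * (n : ℝ) ^ (2 / p) * ∑ i, Schatten.schattenNorm p (A i) ^ 2 ∧
      ∑ i, ∑ j, Schatten.schattenNorm p (A i - A j) ^ 2
          ≤ 2 * (n : ℝ) ^ (2 / p) * ∑ i, Schatten.schattenNorm p (A i) ^ 2) ∧
    (2 ≤ p →
      2 * (n : ℝ) ^ (2 / p) * ∑ i, Schatten.schattenNorm p (A i) ^ 2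
          ≤ ∑ i, ∑ j, Schatten.schattenNorm p (A i + A j) ^ 2 ∧
      2 * (n : ℝ) ^ (2 / p) * ∑ i, Schatten.schattenNorm p (A i) ^ 2
          ≤ ∑ i, ∑ j, Schatten.schattenNorm p (A i - A j) ^ 2) ∧
    (p = 2 →
      ∑ i, ∑ j, Schatten.schattenNorm 2 (A i - A j) ^ 2
          = 2 * (n : ℝ) * ∑ i, Schatten.schattenNorm 2 (A i) ^ 2) := by

  have hadd : ∀ x : Fin n × Fin n, A x.1 + A x.2 ∈ Schatten.schattenClass H p :=
    fun x => Schatten.add_mem_schattenClass hp (hA _) (hA _)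
  have hsub : ∀ x : Fin n × Fin n, A x.1 - A x.2 ∈ Schatten.schattenClass H p :=
    fun x => Schatten.sub_mem_schattenClass hp (hA _) (hA _)
  have hadd' := Schatten.sum_star_mul_self_add hsum
  have hsub' := Schatten.sum_star_mul_self_sub hsum
  refine ⟨fun i j => ⟨hadd (i, j), hsub (i, j)⟩, fun h => ⟨?_, ?_⟩, fun h => ⟨?_, ?_⟩, ?_⟩
  · exact Schatten.sum_schattenNorm_sq_le (B := fun x => A x.1 + A x.2) hp h hA hadd hadd'
  · exact Schatten.sum_schattenNorm_sq_le (B := fun x => A x.1 - A x.2) hp h hA hsub hsub'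
  · exact Schatten.le_sum_schattenNorm_sq (B := fun x => A x.1 + A x.2) h hA hadd hadd'
  · exact Schatten.le_sum_schattenNorm_sq (B := fun x => A x.1 - A x.2) h hA hsub hsub'
  -- At `p = 2` both inequalities apply, with `n ^ (2 / p) = n`.
  · rintro rfl
    have h1 := Schatten.sum_schattenNorm_sq_le hp le_rfl hA (B := fun x => A x.1 - A x.2) hsub hsub'
    have h2 := Schatten.le_sum_schattenNorm_sq le_rfl hA (B := fun x => A x.1 - A x.2) hsub hsub'
    rw [div_self two_ne_zero, Real.rpow_one] at h1 h2
    exact le_antisymm h1 h2
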